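/- **Setting.** Let $n\ge 1$. A Lottery Colonel Blotto game on the battlefields $[n]=\{1,\dots,n\}$ is given by budgets $x_a,x_b>0$ (real numbers) of a leader $a$ and a follower $b$, and by values $v_{aj},v_{bj}\in\mathbb{Q}_{>0}$ for $j\in[n]$. A strategy of player $i\in\{a,b\}$ is a vector $\boldsymbol{x}_i=(x_{i1},\dots,x_{in})$ with $x_{ij}\ge 0$ and $\sum_j x_{ij}=x_i$. The utilities are $$u_a(\boldsymbol{x}_a,\boldsymbol{x}_b)=\sum_{j=1}^n\frac{x_{aj}v_{aj}}{x_{aj}+x_{bj}},\qquad u_b(\boldsymbol{x}_a,\boldsymbol{x}_b)=\sum_{j=1}^n\frac{x_{bj}v_{bj}}{x_{aj}+x_{bj}},$$ where a battlefield with $x_{aj}=x_{bj}=0$ is won by the follower, i.e. contributes $0$ to $u_a$ and $v_{bj}$ to $u_b$. A Nash equilibrium is a pair of strategies that are best responses to each other. A Stackelberg equilibrium is a pair $(\boldsymbol{x}_a,\boldsymbol{x}_b)$ of strategies such that $\boldsymbol{x}_b$ is a best response to $\boldsymbol{x}_a$, and $u_a(\boldsymbol{x}_a',\boldsymbol{x}_b')\le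 u_a(\boldsymbol{x}_a,\boldsymbol{x}_b)$ for every leader strategy $\boldsymbol{x}_a'$ and every follower best response $\boldsymbol{x}_b'$ to $\boldsymbol{x}_a'$. **The function $f$.** Put $$\Psi_1(\xi_1,\xi_2,\xi_3,\xi_4)=\left(\frac{\xi_1}{\sqrt{\xi_3}}+\sqrt{\frac{\xi_1^2/\xi_3+\xi_2^2/\xi_4}{\xi_3+\xi_4}}\,\sqrt{\xi_3}\right)^2,$$ $$\Psi_2(\xi_1,\dots,\xi_6)=\frac{\xi_6\xi_4\xi_1\sqrt{\xi_5\xi_3}-\xi_5\xi_3\xi_2\sqrt{\xi_6\xi_4}}{\sqrt{\xi_5\xi_3}+\sqrt{\xi_6\xi_4}},\qquad \Psi_3(\xi_1,\dots,\xi_6)=\frac{\xi_1\xi_4\xi_5\xi_6-\xi_2\xi_3\xi_5\xi_6}{\xi_5+\xi_6},$$ and, with $t_1=\Psi_1(a,c,b,d)$ and $t_2=\Psi_1(c,a,d,b)$, $$f(a,b,c,d)=\frac{\Psi_2(a,c,b,d,t_1,t_2)}{\Psi_2(c,a,d,b,t_2,t_1)+\Psi_3(a,c,b,d,t_1,t_2)}.$$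 (If $a,b,c,d>0$ and $a/b\ne c/d$, the denominator is nonzero. At points where the formula involves a division by zero, $f$ is given an arbitrary value; these only occur below when all the ratios $v_{aj}/v_{bj}$ are equal, in which case condition 1 holds anyway.) **Theorem.** Every such game has a Stackelberg equilibrium, and a Stackelberg equilibrium $(\boldsymbol{x}_a,\boldsymbol{x}_b)$ is also a Nash equilibrium if and only if at least one of the following two conditions holds: 1. there is a constant $c$ such that $v_{aj}/v_{bj}=c$ for all $j\in[n]$; 2. there is a set $M\subsetneq[n]$ with complement $\overline M=[n]\setminus M$ such that $v_{aj}/v_{bj}=v_{ak}/v_{bk}$ for all $j,k\in M$ and also for all $j,k\in\overline M$, and $$\frac{x_a}{x_b}=f\Bigl(\sum_{j\in M}v_{aj},\ \sum_{j\in M}v_{bj},\ \sum_{j\in\overline M}v_{aj},\ \sum_{j\in\overline M}v_{bj}\Bigr).$$ -/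

import Mathlib

/-- A two-player Lottery Colonel Blotto game on the battlefields `Fin n`: budgets `xa`, `xb` of the
leader `a` and the follower `b`, and the values `va j`, `vb j` they assign to battlefield `j`. -/
structure LotteryBlotto (n : ℕ) where
  xa : ℝ
  xb : ℝ
  va : Fin n → ℚ
  vb : Fin n → ℚ
  xa_pos : 0 < xa
  xb_pos : 0 < xb
  va_pos : ∀ j, 0 < va j
  vb_pos : ∀ j, 0 < vb j

namespace LotteryBlotto

/-- Pure strategies with total budget `w`: nonnegative allocations that exhaust the budget. -/
def strategies (n : ℕ) (w : ℝ) : Set (Fin n → ℝ) :=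
  {x | (∀ j, 0 ≤ x j) ∧ ∑ j, x j = w}

variable {n : ℕ} (G : LotteryBlotto n)

/-- Utility of the leader at the profile `(x, y)` (leader plays `x`, follower plays `y`). A
battlefield on which nobody spends anything is won by the follower. -/
noncomputable def leaderUtility (x y : Fin n → ℝ) : ℝ :=
  ∑ j, if x j = 0 ∧ y j = 0 then 0 else x j * (G.va j : ℝ) / (x j + y j)

/-- Utility of the follower at the profile `(x, y)` (leader plays `x`, follower plays `y`). A
battlefield on which nobody spends anything is won by the follower. -/
noncomputable def followerUtility (x y : Fin n → ℝ) : ℝ :=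
  ∑ j, if x j = 0 ∧ y j = 0 then (G.vb j : ℝ) else y j * (G.vb j : ℝ) / (x j + y j)

/-- `y` is a best response of the follower to the leader's strategy `x`. -/
def IsFollowerBestResponse (x y : Fin n → ℝ) : Prop :=
  y ∈ strategies n G.xb ∧
    ∀ y' ∈ strategies n G.xb, G.followerUtility x y' ≤ G.followerUtility x y

/-- `x` is a best response of the leader to the follower's strategy `y`. -/
def IsLeaderBestResponse (x y : Fin n → ℝ) : Prop :=
  x ∈ strategies n G.xa ∧
    ∀ x' ∈ strategies n G.xa, G.leaderUtility x' y ≤ G.leaderUtility x y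

/-- `(x, y)` is a Nash equilibrium: the two strategies are mutual best responses. -/
def IsNashEquilibrium (x y : Fin n → ℝ) : Prop :=
  G.IsLeaderBestResponse x y ∧ G.IsFollowerBestResponse x y

/-- `(x, y)` is a Stackelberg equilibrium: `y` is a best response to the commitment `x`, and no
commitment of the leader, answered by a best response of the follower, gives the leader more. -/
def IsStackelbergEquilibrium (x y : Fin n → ℝ) : Prop :=
  x ∈ strategies n G.xa ∧ G.IsFollowerBestResponse x y ∧
    ∀ x' ∈ strategies n G.xa, ∀ y', G.IsFollowerBestResponse x' y' →
      G.leaderUtility x' y' ≤ G.leaderUtility x y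

end LotteryBlotto

/-- The auxiliary function `Ψ₁`. -/
noncomputable def blottoPsi1 (ξ₁ ξ₂ ξ₃ ξ₄ : ℝ) : ℝ :=
  (ξ₁ / √ξ₃ + √((ξ₁ ^ 2 / ξ₃ + ξ₂ ^ 2 / ξ₄) / (ξ₃ + ξ₄)) * √ξ₃) ^ 2

/-- The auxiliary function `Ψ₂`. -/
noncomputable def blottoPsi2 (ξ₁ ξ₂ ξ₃ ξ₄ ξ₅ ξ₆ : ℝ) : ℝ :=
  ξ₆ * ξ₄ * ξ₁ * √(ξ₅ * ξ₃) / (√(ξ₅ * ξ₃) + √(ξ₆ * ξ₄)) -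
    ξ₅ * ξ₃ * ξ₂ * √(ξ₆ * ξ₄) / (√(ξ₅ * ξ₃) + √(ξ₆ * ξ₄))

/-- The auxiliary function `Ψ₃`. -/
noncomputable def blottoPsi3 (ξ₁ ξ₂ ξ₃ ξ₄ ξ₅ ξ₆ : ℝ) : ℝ :=
  ξ₁ * ξ₄ * ξ₆ * ξ₅ / (ξ₅ + ξ₆) - ξ₆ * ξ₅ * ξ₃ * ξ₂ / (ξ₅ + ξ₆)

/-- The critical budget ratio, as a function of the total values `a`, `b` that leader and follower
assign to the first class of battlefields, and `c`, `d` that they assign to the second class. -/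
noncomputable def blottoF (a b c d : ℝ) : ℝ :=
  let t₁ := blottoPsi1 a c b d
  let t₂ := blottoPsi1 c a d b
  let t₃ := blottoPsi2 c a d b t₂ t₁ + blottoPsi3 a c b d t₁ t₂
  let t₄ := blottoPsi2 a c b d t₁ t₂
  t₄ / t₃

/-!
The problem becomes transparent in terms of the leader's winning shares
`p j = x j / (x j + y j)`, in which the leader's utility is the linear form `∑ j, va j * p j`.

Write `θ = xa / (xa + xb)`. If the follower best responds with multiplier `l`, then
`vb j * p j ^ 2 ≤ l * x j` and `vb j * p j * (1 - p j) = l * y j` for all `j`. Summing over `j`,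
the shares lie in the unit cube and in the ball `∑ vb j * p j ^ 2 ≤ θ * ∑ vb j * p j`
(`winShare_mem_feasibleShares`). Conversely, every nonzero point of the cube on the sphere arises
from a commitment (`exists_profile_of_tight`), and a maximizer of the linear form over cube and
ball lies on the sphere (`feasibleShares_tight_of_isMaxOn`). So Stackelberg equilibria exist, and
their shares are exactly such maximizers.

In a Nash equilibrium all allocations are positive, hence the shares lie in the interior of the
cube, and a Stackelberg equilibrium must have the shares
`p j = θ / 2 * (1 + u j)` of the maximizer over the whole ball, where `u j` is `va j / vb j` divided
by the quadratic mean `ρ` of these ratios. The leader's first-order condition says that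
`u j * (1 - p j) / p j` does not depend on `j`, and for two battlefields with these shares it reads
`(u j - u k) * (θ * (1 + u j) * (1 + u k) - 2) = 0`. Conversely, if this holds for all pairs, then
the maximizer over the ball lies in the interior of the cube, so it gives the shares of every
Stackelberg equilibrium, and the first-order conditions are sufficient by concavity
(`IsStackelbergEquilibrium.isNashEquilibrium_iff`). The pairwise condition leaves at most two
values of `u`; if there are two, then it determines `θ`, and `blottoF` is the resulting budget
ratio `2 * ρ ^ 2 / ((ρ + r) * (ρ + s) - 2 * ρ ^ 2)`, with `r` and `s` the two ratios
(`blottoF_eq`, `budget_ratio_eq_blottoF_iff`).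
-/

open Filter Topology

/-! ### The critical budget ratio -/

/-- The denominator in the closed form of `blottoF` is positive: one of two different positive
numbers exceeds their weighted quadratic mean `ρ`. -/
theorem two_mul_sq_lt_of_ratio_ne {b d r s ρ : ℝ} (hb : 0 < b) (hd : 0 < d) (hr : 0 < r)
    (hs : 0 < s) (hρ : 0 < ρ) (hrs : r ≠ s) (h : ρ ^ 2 * (b + d) = r ^ 2 * b + s ^ 2 * d) :
    2 * ρ ^ 2 < (ρ + r) * (ρ + s) := by
  have key : ρ < r ∨ ρ < s := by
    by_contra! hcon
    have h1 : r ^ 2 ≤ ρ ^ 2 := pow_le_pow_left₀ hr.le hcon.1 2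
    have h2 : s ^ 2 ≤ ρ ^ 2 := pow_le_pow_left₀ hs.le hcon.2 2
    have h3 : r ^ 2 = ρ ^ 2 := by nlinarith
    have h4 : s ^ 2 = ρ ^ 2 := by nlinarith
    exact hrs ((pow_left_inj₀ hr.le hs.le two_ne_zero).1 (h3.trans h4.symm))
  rcases key with h1 | h1 <;> nlinarith [mul_pos hr hs, mul_pos hρ hr, mul_pos hρ hs]

theorem blottoPsi1_eq {b d r s ρ : ℝ} (hb : 0 < b) (hd : 0 < d) (hρ : 0 < ρ)
    (h : ρ ^ 2 * (b + d) = r ^ 2 * b + s ^ 2 * d) :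
    blottoPsi1 (r * b) (s * d) b d = b * (r + ρ) ^ 2 := by
  have h1 : ((r * b) ^ 2 / b + (s * d) ^ 2 / d) / (b + d) = ρ ^ 2 := by
    rw [div_eq_iff (by positivity), h]
    field_simp
  have h2 : r * b / √b = r * √b := by
    rw [div_eq_iff (by positivity), mul_assoc, Real.mul_self_sqrt hb.le]
  rw [blottoPsi1, h1, Real.sqrt_sq hρ.le, h2, ← add_mul, mul_pow, Real.sq_sqrt hb.le]
  ring

/-- Closed form of `blottoF` when the two classes of battlefields have value ratios `r ≠ s`
and `ρ` is the weighted quadratic mean of these ratios. -/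
theorem blottoF_eq {b d r s ρ : ℝ} (hb : 0 < b) (hd : 0 < d) (hr : 0 < r)
    (hs : 0 < s) (hρ : 0 < ρ) (hrs : r ≠ s) (h : ρ ^ 2 * (b + d) = r ^ 2 * b + s ^ 2 * d) :
    blottoF (r * b) b (s * d) d = 2 * ρ ^ 2 / ((ρ + r) * (ρ + s) - 2 * ρ ^ 2) := by
  have hlt := two_mul_sq_lt_of_ratio_ne hb hd hr hs hρ hrs h
  have e1 := blottoPsi1_eq hb hd hρ h
  have e2 : blottoPsi1 (s * d) (r * b) d b = d * (s + ρ) ^ 2 :=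
    blottoPsi1_eq hd hb hρ (by linarith)
  have s1 : √(b * (r + ρ) ^ 2 * b) = b * (r + ρ) := by
    rw [show b * (r + ρ) ^ 2 * b = (b * (r + ρ)) ^ 2 by ring, Real.sqrt_sq (by positivity)]
  have s2 : √(d * (s + ρ) ^ 2 * d) = d * (s + ρ) := by
    rw [show d * (s + ρ) ^ 2 * d = (d * (s + ρ)) ^ 2 by ring, Real.sqrt_sq (by positivity)]
  have hsum : b * (r + ρ) ^ 2 + d * (s + ρ) ^ 2 = 2 * ρ * (b * (r + ρ) + d * (s + ρ)) := by
    linarith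
  set S := b * (r + ρ) + d * (s + ρ) with hS
  have hSpos : 0 < S := by positivity
  have hN : blottoPsi2 (r * b) (s * d) b d (b * (r + ρ) ^ 2) (d * (s + ρ) ^ 2) =
      b ^ 2 * d ^ 2 * (r + ρ) * (s + ρ) * (r - s) * ρ / S := by
    rw [blottoPsi2, s1, s2, ← sub_div, ← hS]
    congr 1
    ring
  have hN' : blottoPsi2 (s * d) (r * b) d b (d * (s + ρ) ^ 2) (b * (r + ρ) ^ 2) =
      -(b ^ 2 * d ^ 2 * (r + ρ) * (s + ρ) * (r - s) * ρ / S) := by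
    rw [blottoPsi2, s1, s2, ← sub_div, add_comm (d * (s + ρ)), ← hS, ← neg_div]
    congr 1
    ring
  have hP : blottoPsi3 (r * b) (s * d) b d (b * (r + ρ) ^ 2) (d * (s + ρ) ^ 2) =
      b ^ 2 * d ^ 2 * (r + ρ) ^ 2 * (s + ρ) ^ 2 * (r - s) / (2 * ρ * S) := by
    rw [blottoPsi3, hsum, ← sub_div]
    congr 1
    ring
  simp only [blottoF, e1, e2, hN, hN', hP]
  have hne : (ρ + r) * (ρ + s) - 2 * ρ ^ 2 ≠ 0 := (sub_pos.2 hlt).ne'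
  have hrs' : r - s ≠ 0 := sub_ne_zero.2 hrs
  have hden : -(b ^ 2 * d ^ 2 * (r + ρ) * (s + ρ) * (r - s) * ρ / S) +
      b ^ 2 * d ^ 2 * (r + ρ) ^ 2 * (s + ρ) ^ 2 * (r - s) / (2 * ρ * S) =
      (b ^ 2 * d ^ 2 * (r + ρ) * (s + ρ) * (r - s)) * ((ρ + r) * (ρ + s) - 2 * ρ ^ 2) /
        (2 * ρ * S) := by
    field_simp
    ring
  have hC : b ^ 2 * d ^ 2 * (r + ρ) * (s + ρ) * (r - s) ≠ 0 := by positivity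
  rw [hden]
  generalize b ^ 2 * d ^ 2 * (r + ρ) * (s + ρ) * (r - s) = C at *
  generalize (ρ + r) * (ρ + s) - 2 * ρ ^ 2 = D at *
  field_simp

/-! ### Maximizing a linear form over a box and a ball -/

section Ball

variable {n : ℕ}

/-- The vectors in the unit cube that lie in the (weighted) ball
`∑ j, b j * p j ^ 2 ≤ θ * ∑ j, b j * p j`, which has `0` on its boundary and center
`(θ / 2, …, θ / 2)`. -/
def feasibleShares (b : Fin n → ℝ) (θ : ℝ) : Set (Fin n → ℝ) :=
  {p | (∀ j, 0 ≤ p j ∧ p j ≤ 1) ∧ ∑ j, b j * p j ^ 2 ≤ θ * ∑ j, b j * p j}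

/-- The quadratic mean of the ratios `a j / b j`, with weights `b j`. -/
noncomputable def meanRatio (a b : Fin n → ℝ) : ℝ :=
  √((∑ j, a j ^ 2 / b j) / ∑ j, b j)

/-- The maximizer of `p ↦ ∑ j, a j * p j` over the ball
`∑ j, b j * p j ^ 2 ≤ θ * ∑ j, b j * p j`. -/
noncomputable def ballOptimum (a b : Fin n → ℝ) (θ : ℝ) (j : Fin n) : ℝ :=
  θ / 2 * (1 + a j / b j / meanRatio a b)

theorem sum_pos_of_one_le (hn : 1 ≤ n) {b : Fin n → ℝ} (hb : ∀ j, 0 < b j) : 0 < ∑ j, b j :=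
  Finset.sum_pos (fun j _ => hb j) ⟨⟨0, hn⟩, Finset.mem_univ _⟩

theorem meanRatio_pos (hn : 1 ≤ n) {a b : Fin n → ℝ} (ha : ∀ j, 0 < a j) (hb : ∀ j, 0 < b j) :
    0 < meanRatio a b :=
  Real.sqrt_pos.2 <| div_pos
    (sum_pos_of_one_le hn fun j => div_pos (pow_pos (ha j) 2) (hb j)) (sum_pos_of_one_le hn hb)

theorem meanRatio_sq (hn : 1 ≤ n) {a b : Fin n → ℝ} (ha : ∀ j, 0 < a j) (hb : ∀ j, 0 < b j) :
    meanRatio a b ^ 2 * ∑ j, b j = ∑ j, a j ^ 2 / b j := by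
  have h1 := sum_pos_of_one_le hn hb
  have h2 := sum_pos_of_one_le hn fun j => div_pos (pow_pos (ha j) 2) (hb j)
  rw [meanRatio, Real.sq_sqrt (div_pos h2 h1).le, div_mul_cancel₀ _ h1.ne']

theorem ballOptimum_tight (hn : 1 ≤ n) {a b : Fin n → ℝ} (ha : ∀ j, 0 < a j)
    (hb : ∀ j, 0 < b j) (θ : ℝ) :
    ∑ j, b j * ballOptimum a b θ j ^ 2 = θ * ∑ j, b j * ballOptimum a b θ j := by
  have hρ := meanRatio_pos hn ha hb
  have hsq := meanRatio_sq hn ha hb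
  rw [← sub_eq_zero, Finset.mul_sum, ← Finset.sum_sub_distrib]
  have : ∀ j, b j * ballOptimum a b θ j ^ 2 - θ * (b j * ballOptimum a b θ j) =
      θ ^ 2 / 4 / meanRatio a b ^ 2 * (a j ^ 2 / b j) - θ ^ 2 / 4 * b j := by
    intro j
    have := (hb j).ne'
    rw [ballOptimum]
    field_simp
    ring
  rw [Finset.sum_congr rfl fun j _ => this j, Finset.sum_sub_distrib, ← Finset.mul_sum,
    ← Finset.mul_sum, ← hsq]
  field_simp
  ring

/-- The quantitative form of the optimality of `ballOptimum`: it beats every point of the ball by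
a multiple of the squared weighted distance. -/
theorem sum_sq_dist_ballOptimum_le (hn : 1 ≤ n) {a b : Fin n → ℝ} (ha : ∀ j, 0 < a j)
    (hb : ∀ j, 0 < b j) {θ : ℝ} {p : Fin n → ℝ}
    (hp : ∑ j, b j * p j ^ 2 ≤ θ * ∑ j, b j * p j) :
    ∑ j, b j * (ballOptimum a b θ j - p j) ^ 2 ≤
      θ / meanRatio a b * (∑ j, a j * ballOptimum a b θ j - ∑ j, a j * p j) := by
  have hρ := meanRatio_pos hn ha hb
  have htight := ballOptimum_tight hn ha hb θ
  set q := ballOptimum a b θ with hq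
  have hbq : ∀ j, b j * q j = θ / 2 * b j + θ / meanRatio a b / 2 * a j := by
    intro j
    have := (hb j).ne'
    rw [hq, ballOptimum]
    field_simp
  have hcross : ∀ z : Fin n → ℝ, ∑ j, b j * q j * z j =
      θ / 2 * ∑ j, b j * z j + θ / meanRatio a b / 2 * ∑ j, a j * z j := by
    intro z
    rw [Finset.mul_sum, Finset.mul_sum, ← Finset.sum_add_distrib]
    refine Finset.sum_congr rfl fun j _ => ?_
    rw [hbq]
    ring
  have hqq := hcross q
  have hqp := hcross p
  have hexp : ∑ j, b j * (q j - p j) ^ 2 =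
      ∑ j, b j * q j ^ 2 - 2 * ∑ j, b j * q j * p j + ∑ j, b j * p j ^ 2 := by
    rw [Finset.mul_sum, ← Finset.sum_sub_distrib, ← Finset.sum_add_distrib]
    exact Finset.sum_congr rfl fun j _ => by ring
  have hqq' : ∑ j, b j * q j * q j = ∑ j, b j * q j ^ 2 :=
    Finset.sum_congr rfl fun j _ => by ring
  rw [hexp, hqp, mul_sub]
  rw [hqq'] at hqq
  linarith

theorem eq_ballOptimum_of_le (hn : 1 ≤ n) {a b : Fin n → ℝ} (ha : ∀ j, 0 < a j)
    (hb : ∀ j, 0 < b j) {θ : ℝ} (hθ : 0 < θ) {p : Fin n → ℝ}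
    (hp : ∑ j, b j * p j ^ 2 ≤ θ * ∑ j, b j * p j)
    (hle : ∑ j, a j * ballOptimum a b θ j ≤ ∑ j, a j * p j) : p = ballOptimum a b θ := by
  have h := sum_sq_dist_ballOptimum_le hn ha hb hp
  have hρ := meanRatio_pos hn ha hb
  have h0 : ∑ j, b j * (ballOptimum a b θ j - p j) ^ 2 ≤ 0 :=
    h.trans (mul_nonpos_of_nonneg_of_nonpos (by positivity) (sub_nonpos.2 hle))
  have hnn : ∀ j ∈ Finset.univ, 0 ≤ b j * (ballOptimum a b θ j - p j) ^ 2 :=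
    fun j _ => mul_nonneg (hb j).le (sq_nonneg _)
  have h1 := (Finset.sum_eq_zero_iff_of_nonneg hnn).1 (le_antisymm h0 (Finset.sum_nonneg hnn))
  funext j
  have h2 := h1 j (Finset.mem_univ j)
  have h3 := (mul_eq_zero.1 h2).resolve_left (hb j).ne'
  exact (sub_eq_zero.1 (pow_eq_zero_iff two_ne_zero |>.1 h3)).symm

theorem exists_isMaxOn_feasibleShares (a b : Fin n → ℝ) (θ : ℝ) :
    ∃ p ∈ feasibleShares b θ, IsMaxOn (fun q => ∑ j, a j * q j) (feasibleShares b θ) p := by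
  have hset : feasibleShares b θ = Set.Icc 0 1 ∩
      {p | ∑ j, b j * p j ^ 2 ≤ θ * ∑ j, b j * p j} := by
    ext p
    simp [feasibleShares, Set.mem_Icc, Pi.le_def, forall_and]
  have hcpt : IsCompact (feasibleShares b θ) := by
    rw [hset]
    exact isCompact_Icc.inter_right (isClosed_le (by fun_prop) (by fun_prop))
  exact hcpt.exists_isMaxOn ⟨0, by simp [feasibleShares]⟩ (by fun_prop)

theorem const_mem_feasibleShares (b : Fin n → ℝ) {θ : ℝ} (h0 : 0 ≤ θ) (h1 : θ ≤ 1) :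
    (fun _ => θ) ∈ feasibleShares b θ := by
  refine ⟨fun _ => ⟨h0, h1⟩, le_of_eq ?_⟩
  rw [Finset.mul_sum]
  exact Finset.sum_congr rfl fun j _ => by ring

/-- A maximizer over the box and the ball lies on the sphere, since it could otherwise be moved
towards the corner `(1, …, 1)`, which lies outside the ball. -/
theorem feasibleShares_tight_of_isMaxOn (hn : 1 ≤ n) {a b : Fin n → ℝ} (ha : ∀ j, 0 < a j)
    (hb : ∀ j, 0 < b j) {θ : ℝ} (h1 : θ < 1) {p : Fin n → ℝ} (hp : p ∈ feasibleShares b θ)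
    (hmax : IsMaxOn (fun q => ∑ j, a j * q j) (feasibleShares b θ) p) :
    ∑ j, b j * p j ^ 2 = θ * ∑ j, b j * p j := by
  by_contra hne
  have hlt := lt_of_le_of_ne hp.2 hne
  have hex : ∃ k, p k < 1 := by
    by_contra! hcon
    have hp1 : ∀ j, p j = 1 := fun j => le_antisymm (hp.1 j).2 (hcon j)
    simp only [hp1, one_pow, mul_one] at hlt
    nlinarith [sum_pos_of_one_le hn hb]
  obtain ⟨k, hk⟩ := hex
  let q : ℝ → Fin n → ℝ := fun ε j => p j + ε * (1 - p j)
  have hev : ∀ᶠ ε in 𝓝[>] (0 : ℝ),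
      ∑ j, b j * q ε j ^ 2 < θ * ∑ j, b j * q ε j := by
    refine nhdsWithin_le_nhds ?_
    refine Filter.Tendsto.eventually_lt (f := fun ε => ∑ j, b j * q ε j ^ 2)
      (g := fun ε => θ * ∑ j, b j * q ε j)
      (Continuous.tendsto (by fun_prop) 0) (Continuous.tendsto (by fun_prop) 0) ?_
    simpa [q] using hlt
  obtain ⟨ε, hε, hε0, hε1⟩ := (hev.and (Ioo_mem_nhdsGT (one_pos))).exists
  have hq : q ε ∈ feasibleShares b θ := by
    refine ⟨fun j => ⟨?_, ?_⟩, hε.le⟩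
    · have := hp.1 j
      have := mul_nonneg hε0.le (sub_nonneg.2 this.2)
      simp only [q]
      linarith
    · have := hp.1 j
      simp only [q]
      nlinarith
  have hle : ∑ j, a j * q ε j ≤ ∑ j, a j * p j := hmax hq
  refine hle.not_gt (Finset.sum_lt_sum (fun j _ => ?_) ⟨k, Finset.mem_univ k, ?_⟩)
  · have := mul_nonneg hε0.le (sub_nonneg.2 (hp.1 j).2)
    exact mul_le_mul_of_nonneg_left (by simp only [q]; linarith) (ha j).le
  · have := mul_pos hε0 (sub_pos.2 hk)
    exact mul_lt_mul_of_pos_left (by simp only [q]; linarith) (ha k)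

/-- A maximizer in the interior of the box is the maximizer over the whole ball, since it could
otherwise be moved towards the latter. -/
theorem eq_ballOptimum_of_isMaxOn_of_interior (hn : 1 ≤ n) {a b : Fin n → ℝ} (ha : ∀ j, 0 < a j)
    (hb : ∀ j, 0 < b j) {θ : ℝ} (hθ : 0 < θ) {p : Fin n → ℝ} (hp : p ∈ feasibleShares b θ)
    (hmax : IsMaxOn (fun q => ∑ j, a j * q j) (feasibleShares b θ) p)
    (hint : ∀ j, 0 < p j ∧ p j < 1) : p = ballOptimum a b θ := by
  refine eq_ballOptimum_of_le hn ha hb hθ hp.2 ?_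
  have htight := ballOptimum_tight hn ha hb θ
  set r := ballOptimum a b θ
  let q : ℝ → Fin n → ℝ := fun ε j => p j + ε * (r j - p j)
  have hev : ∀ᶠ ε in 𝓝[>] (0 : ℝ), ∀ j, 0 < q ε j ∧ q ε j < 1 := by
    refine nhdsWithin_le_nhds (eventually_all.2 fun j => ?_)
    have ht : Tendsto (fun ε => q ε j) (𝓝 0) (𝓝 (p j)) := by
      have : Continuous fun ε => q ε j := by fun_prop
      simpa [q] using this.tendsto 0
    exact ht.eventually (Ioo_mem_nhds (hint j).1 (hint j).2)
  obtain ⟨ε, hε, hε0, hε1⟩ := (hev.and (Ioo_mem_nhdsGT (one_pos))).exists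
  have hq : q ε ∈ feasibleShares b θ := by
    refine ⟨fun j => ⟨(hε j).1.le, (hε j).2.le⟩, ?_⟩
    have e1 : ∑ j, b j * q ε j ^ 2 ≤
        (1 - ε) * ∑ j, b j * p j ^ 2 + ε * ∑ j, b j * r j ^ 2 := by
      rw [Finset.mul_sum, Finset.mul_sum, ← Finset.sum_add_distrib]
      refine Finset.sum_le_sum fun j _ => ?_
      have : 0 ≤ b j * (ε * (1 - ε) * (r j - p j) ^ 2) :=
        mul_nonneg (hb j).le (mul_nonneg (mul_nonneg hε0.le (by linarith)) (sq_nonneg _))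
      simp only [q]
      nlinarith
    have e2 : ∑ j, b j * q ε j = (1 - ε) * ∑ j, b j * p j + ε * ∑ j, b j * r j := by
      rw [Finset.mul_sum, Finset.mul_sum, ← Finset.sum_add_distrib]
      exact Finset.sum_congr rfl fun j _ => by simp only [q]; ring
    have e3 := mul_le_mul_of_nonneg_left hp.2 (sub_nonneg.2 hε1.le)
    rw [e2]
    rw [htight] at e1
    linarith
  have hle : ∑ j, a j * q ε j ≤ ∑ j, a j * p j := hmax hq
  have e4 : ∑ j, a j * q ε j = ∑ j, a j * p j + ε * (∑ j, a j * r j - ∑ j, a j * p j) := by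
    rw [← Finset.sum_sub_distrib, Finset.mul_sum, ← Finset.sum_add_distrib]
    exact Finset.sum_congr rfl fun j _ => by simp only [q]; ring
  rw [e4] at hle
  by_contra! hcon
  have := mul_pos hε0 (sub_pos.2 hcon)
  linarith

end Ball

/-! ### Separable payoffs on the simplex of strategies -/

namespace LotteryBlotto

variable {n : ℕ}

/-- Moving budget from one battlefield to another does not improve an optimal strategy. -/
theorem exchange_le {w : ℝ} {τ : Fin n → ℝ → ℝ} {z : Fin n → ℝ} (hz : z ∈ strategies n w)
    (hmax : ∀ z' ∈ strategies n w, ∑ i, τ i (z' i) ≤ ∑ i, τ i (z i)) {j k : Fin n} (hjk : j ≠ k)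
    {ε : ℝ} (h0 : 0 ≤ ε) (h1 : ε ≤ z j) :
    τ k (z k + ε) + τ j (z j - ε) ≤ τ k (z k) + τ j (z j) := by
  let z' : Fin n → ℝ := Function.update (Function.update z j (z j - ε)) k (z k + ε)
  have hk : z' k = z k + ε := by simp [z']
  have hj : z' j = z j - ε := by simp [z', hjk]
  have ho : ∀ i, i ≠ j ∧ i ≠ k → z' i = z i := fun i hi => by simp [z', hi.1, hi.2]
  have hmem : z' ∈ strategies n w := by
    refine ⟨fun i => ?_, ?_⟩
    · by_cases hik : i = k
      · rw [hik, hk]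
        linarith [hz.1 k]
      · by_cases hij : i = j
        · rw [hij, hj]
          linarith
        · rw [ho i ⟨hij, hik⟩]
          exact hz.1 i
    · have := Fintype.sum_eq_add (f := fun i => z' i - z i) j k hjk
        fun i hi => by simp [ho i hi]
      rw [Finset.sum_sub_distrib, hz.2, hk, hj] at this
      linarith
  have h := hmax z' hmem
  have hs := Fintype.sum_eq_add (f := fun i => τ i (z' i) - τ i (z i)) j k hjk
    fun i hi => by simp [ho i hi]
  rw [Finset.sum_sub_distrib, hk, hj] at hs
  linarith

/-- First-order condition at an optimal strategy against positive allocations `o` and `o'` on two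
battlefields: a battlefield that receives some budget has maximal marginal payoff. -/
theorem marginal_le {w : ℝ} {τ : Fin n → ℝ → ℝ} {z : Fin n → ℝ} (hz : z ∈ strategies n w)
    (hmax : ∀ z' ∈ strategies n w, ∑ i, τ i (z' i) ≤ ∑ i, τ i (z i)) {j k : Fin n}
    {v v' o o' : ℝ} (ho : 0 < o) (ho' : 0 < o') (hτ : ∀ t, τ j t = v * (t / (o + t)))
    (hτ' : ∀ t, τ k t = v' * (t / (o' + t))) (hzj : 0 < z j) (hjk : j ≠ k) :
    v' * o' / (o' + z k) ^ 2 ≤ v * o / (o + z j) ^ 2 := by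
  have hzk := hz.1 k
  have hlim' : Tendsto (fun ε => v' * o' / ((o' + z k) * (o' + z k + ε))) (𝓝[>] 0)
      (𝓝 (v' * o' / (o' + z k) ^ 2)) := by
    have : ContinuousAt (fun ε => v' * o' / ((o' + z k) * (o' + z k + ε))) 0 :=
      ContinuousAt.div (by fun_prop) (by fun_prop) (by positivity)
    have h := this.tendsto
    simp only [add_zero, ← pow_two] at h
    exact h.mono_left nhdsWithin_le_nhds
  have hlim : Tendsto (fun ε => v * o / ((o + z j) * (o + z j - ε))) (𝓝[>] 0)
      (𝓝 (v * o / (o + z j) ^ 2)) := by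
    have : ContinuousAt (fun ε => v * o / ((o + z j) * (o + z j - ε))) 0 :=
      ContinuousAt.div (by fun_prop) (by fun_prop) (by simp; positivity)
    have h := this.tendsto
    simp only [sub_zero, ← pow_two] at h
    exact h.mono_left nhdsWithin_le_nhds
  refine le_of_tendsto_of_tendsto hlim' hlim ?_
  filter_upwards [Ioo_mem_nhdsGT hzj] with ε hε
  have h := exchange_le hz hmax hjk hε.1.le hε.2.le
  rw [hτ, hτ, hτ', hτ'] at h
  have hε0 := hε.1
  have hs : 0 < o + (z j - ε) := by linarith [hε.2]
  have hs' : 0 < o + z j - ε := by linarith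
  have e1 : v' * ((z k + ε) / (o' + (z k + ε))) - v' * (z k / (o' + z k)) =
      ε * (v' * o' / ((o' + z k) * (o' + z k + ε))) := by
    have : 0 < o' + (z k + ε) := by positivity
    have : 0 < o' + z k := by positivity
    have : 0 < o' + z k + ε := by positivity
    field_simp
    ring
  have e2 : v * (z j / (o + z j)) - v * ((z j - ε) / (o + (z j - ε))) =
      ε * (v * o / ((o + z j) * (o + z j - ε))) := by
    have : 0 < o + z j := by positivity
    field_simp
    ring
  exact le_of_mul_le_mul_left (by rw [← e1, ← e2]; linarith) hε0

/-- A strategy is optimal if all summands of the payoff have tangents of a common slope. -/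
theorem sum_le_of_tangent {w l : ℝ} {τ : Fin n → ℝ → ℝ} {z : Fin n → ℝ}
    (hz : z ∈ strategies n w) (h : ∀ j, ∀ t, 0 ≤ t → τ j t ≤ τ j (z j) + l * (t - z j)) :
    ∀ z' ∈ strategies n w, ∑ j, τ j (z' j) ≤ ∑ j, τ j (z j) := by
  intro z' hz'
  have h1 := Finset.sum_le_sum fun j (_ : j ∈ Finset.univ) => h j (z' j) (hz'.1 j)
  rwa [Finset.sum_add_distrib, ← Finset.mul_sum, Finset.sum_sub_distrib, hz.2, hz'.2, sub_self,
    mul_zero, add_zero] at h1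

theorem lottery_le_tangent {v o z t : ℝ} (hv : 0 ≤ v) (ho : 0 < o) (hz : 0 ≤ z) (ht : 0 ≤ t) :
    v * (t / (o + t)) ≤ v * (z / (o + z)) + v * o / (o + z) ^ 2 * (t - z) := by
  have e : v * (z / (o + z)) + v * o / (o + z) ^ 2 * (t - z) - v * (t / (o + t)) =
      v * o * (t - z) ^ 2 / ((o + z) ^ 2 * (o + t)) := by
    have : 0 < o + z := by positivity
    have : 0 < o + t := by positivity
    field_simp
    ring
  have : 0 ≤ v * o * (t - z) ^ 2 / ((o + z) ^ 2 * (o + t)) := by positivity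
  linarith

/-! ### Best responses in terms of the leader's winning shares -/

variable (G : LotteryBlotto n)

/-- The leader's share `x j / (x j + y j)` of battlefield `j`; the convention `0 / 0 = 0` agrees
with the tie-breaking rule. -/
noncomputable def winShare (x y : Fin n → ℝ) (j : Fin n) : ℝ := x j / (x j + y j)

/-- The leader's fraction of the total budget. -/
noncomputable def budgetShare : ℝ := G.xa / (G.xa + G.xb)

theorem budgetShare_pos : 0 < G.budgetShare := by
  have := G.xa_pos
  have := G.xb_pos
  rw [budgetShare]
  positivity

theorem budgetShare_lt_one : G.budgetShare < 1 := by
  have := G.xa_pos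
  have := G.xb_pos
  rw [budgetShare, div_lt_one (by positivity)]
  linarith

theorem leaderUtility_eq (x y : Fin n → ℝ) :
    G.leaderUtility x y = ∑ j, (G.va j : ℝ) * winShare x y j := by
  refine Finset.sum_congr rfl fun j _ => ?_
  split_ifs with h
  · simp [winShare, h.1]
  · rw [winShare]
    ring

theorem winShare_mem_Icc {x y : Fin n → ℝ} {j : Fin n} (hx : 0 ≤ x j) (hy : 0 ≤ y j) :
    0 ≤ winShare x y j ∧ winShare x y j ≤ 1 :=
  ⟨div_nonneg hx (add_nonneg hx hy), div_le_one_of_le₀ (by linarith) (add_nonneg hx hy)⟩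

theorem exists_pos_of_mem_strategies {w : ℝ} (hw : 0 < w) {x : Fin n → ℝ}
    (hx : x ∈ strategies n w) : ∃ j, 0 < x j := by
  by_contra! hcon
  have := Finset.sum_nonpos fun j (_ : j ∈ Finset.univ) => hcon j
  rw [hx.2] at this
  linarith

theorem follower_term {x : Fin n → ℝ} {j : Fin n} (hx : 0 < x j) (v t : ℝ) :
    (if x j = 0 ∧ t = 0 then v else t * v / (x j + t)) = v * (t / (x j + t)) := by
  rw [if_neg fun h => hx.ne' h.1]
  ring

theorem leader_term {y : Fin n → ℝ} {j : Fin n} (hy : 0 < y j) (v t : ℝ) :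
    (if t = 0 ∧ y j = 0 then 0 else t * v / (t + y j)) = v * (t / (y j + t)) := by
  rw [if_neg fun h => hy.ne' h.2, add_comm]
  ring

variable {G}

/-- The follower spends nothing on a battlefield won without effort. -/
theorem IsFollowerBestResponse.eq_zero {x y : Fin n → ℝ} (hx : x ∈ strategies n G.xa)
    (hy : G.IsFollowerBestResponse x y) {j : Fin n} (hj : x j = 0) : y j = 0 := by
  by_contra hne
  have hyj : 0 < y j := lt_of_le_of_ne (hy.1.1 j) (Ne.symm hne)
  obtain ⟨k, hk⟩ := exists_pos_of_mem_strategies G.xa_pos hx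
  have hjk : j ≠ k := by
    rintro rfl
    exact hk.ne' hj
  have h := exchange_le (τ := fun i t => if x i = 0 ∧ t = 0 then (G.vb i : ℝ)
    else t * (G.vb i : ℝ) / (x i + t)) hy.1 hy.2 hjk hyj.le le_rfl
  have hv : (0 : ℝ) < G.vb k := by exact_mod_cast G.vb_pos k
  have hyk := hy.1.1 k
  simp only [follower_term hk, hj, sub_self, and_self, if_true, hne, and_false, if_false,
    zero_add, mul_div_cancel_left₀ _ hne, add_le_add_iff_right] at h
  have h1 := le_of_mul_le_mul_left h hv
  rw [div_le_div_iff₀ (by positivity) (by positivity)] at h1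
  nlinarith [mul_pos hk hyj]

/-- The follower's first-order conditions, with multiplier `l`, in terms of the leader's shares. -/
theorem IsFollowerBestResponse.exists_multiplier {x y : Fin n → ℝ}
    (hx : x ∈ strategies n G.xa) (hy : G.IsFollowerBestResponse x y) :
    ∃ l : ℝ, 0 < l ∧ ∀ j, (G.vb j : ℝ) * winShare x y j ^ 2 ≤ l * x j ∧
      (G.vb j : ℝ) * winShare x y j * (1 - winShare x y j) = l * y j := by
  have hb : ∀ j, (0 : ℝ) < G.vb j := fun j => by exact_mod_cast G.vb_pos j
  obtain ⟨i, hi⟩ := exists_pos_of_mem_strategies G.xb_pos hy.1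
  have hpos : ∀ j, 0 < y j → 0 < x j := fun j hj =>
    lt_of_le_of_ne (hx.1 j) fun h => hj.ne' (hy.eq_zero hx h.symm)
  have hxi := hpos i hi
  have hmarg : ∀ j k, 0 < y j → 0 < x k →
      (G.vb k : ℝ) * x k / (x k + y k) ^ 2 ≤ (G.vb j : ℝ) * x j / (x j + y j) ^ 2 := by
    intro j k hj hk
    by_cases hjk : j = k
    · rw [hjk]
    · exact marginal_le (τ := fun i t => if x i = 0 ∧ t = 0 then (G.vb i : ℝ)
        else t * (G.vb i : ℝ) / (x i + t)) hy.1 hy.2 (hpos j hj) hk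
        (follower_term (hpos j hj) _) (follower_term hk _) hj hjk
  have hbi := hb i
  refine ⟨(G.vb i : ℝ) * x i / (x i + y i) ^ 2, by positivity, fun k => ?_⟩
  rcases (hx.1 k).eq_or_lt with hk | hk
  · simp [winShare, ← hk, hy.eq_zero hx hk.symm]
  · have hyk := hy.1.1 k
    have hs : 0 < x k + y k := by positivity
    have e1 : (G.vb k : ℝ) * winShare x y k ^ 2 =
        (G.vb k : ℝ) * x k / (x k + y k) ^ 2 * x k := by
      rw [winShare]
      field_simp
    have e2 : (G.vb k : ℝ) * winShare x y k * (1 - winShare x y k) =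
        (G.vb k : ℝ) * x k / (x k + y k) ^ 2 * y k := by
      rw [winShare]
      field_simp
      ring
    rw [e1, e2]
    refine ⟨mul_le_mul_of_nonneg_right (hmarg i k hi hk) hk.le, ?_⟩
    rcases hyk.eq_or_lt with h0 | h0
    · rw [← h0, mul_zero, mul_zero]
    · rw [le_antisymm (hmarg i k hi hk) (hmarg k i h0 hxi)]

theorem sum_share_sub_sq {b p : Fin n → ℝ} :
    ∑ j, b j * p j * (1 - p j) = ∑ j, b j * p j - ∑ j, b j * p j ^ 2 := by
  rw [← Finset.sum_sub_distrib]
  exact Finset.sum_congr rfl fun j _ => by ring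

/-- Whatever the leader commits to, the resulting shares lie in the ball. -/
theorem winShare_mem_feasibleShares {x y : Fin n → ℝ} (hx : x ∈ strategies n G.xa)
    (hy : G.IsFollowerBestResponse x y) :
    winShare x y ∈ feasibleShares (fun j => (G.vb j : ℝ)) G.budgetShare := by
  refine ⟨fun j => winShare_mem_Icc (hx.1 j) (hy.1.1 j), ?_⟩
  obtain ⟨l, hl, h⟩ := hy.exists_multiplier hx
  have h1 := Finset.sum_le_sum fun j (_ : j ∈ Finset.univ) => (h j).1
  have h2 := Finset.sum_congr rfl fun j (_ : j ∈ Finset.univ) => (h j).2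
  rw [← Finset.mul_sum, hx.2] at h1
  rw [← Finset.mul_sum, hy.1.2, sum_share_sub_sq] at h2
  have ha := G.xa_pos
  have hb := G.xb_pos
  rw [budgetShare, div_mul_eq_mul_div, le_div_iff₀ (by positivity)]
  nlinarith

/-- If the shares lie on the sphere, then the leader's allocation is determined by them. -/
theorem exists_multiplier_of_tight {x y : Fin n → ℝ} (hx : x ∈ strategies n G.xa)
    (hy : G.IsFollowerBestResponse x y)
    (ht : ∑ j, (G.vb j : ℝ) * winShare x y j ^ 2 =
      G.budgetShare * ∑ j, (G.vb j : ℝ) * winShare x y j) :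
    ∃ l : ℝ, 0 < l ∧ ∀ j, (G.vb j : ℝ) * winShare x y j ^ 2 = l * x j ∧
      (G.vb j : ℝ) * winShare x y j * (1 - winShare x y j) = l * y j := by
  obtain ⟨l, hl, h⟩ := hy.exists_multiplier hx
  have h2 := Finset.sum_congr rfl fun j (_ : j ∈ Finset.univ) => (h j).2
  rw [← Finset.mul_sum, hy.1.2, sum_share_sub_sq] at h2
  have ha := G.xa_pos
  have hb := G.xb_pos
  have h1 : ∑ j, (G.vb j : ℝ) * winShare x y j ^ 2 = ∑ j, l * x j := by
    rw [← Finset.mul_sum, hx.2]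
    rw [budgetShare, div_mul_eq_mul_div, eq_div_iff (by positivity)] at ht
    refine mul_right_cancel₀ hb.ne' ?_
    linear_combination ht + G.xa * h2
  have h3 := (Finset.sum_eq_sum_iff_of_le fun j _ => (h j).1).1 h1
  exact ⟨l, hl, fun j => ⟨h3 j (Finset.mem_univ j), (h j).2⟩⟩

variable (G)

/-- Every nonzero vector of shares on the sphere arises from a commitment of the leader and the
follower's best response to it. -/
theorem exists_profile_of_tight {p : Fin n → ℝ} (hp : ∀ j, 0 ≤ p j ∧ p j ≤ 1)
    (ht : ∑ j, (G.vb j : ℝ) * p j ^ 2 = G.budgetShare * ∑ j, (G.vb j : ℝ) * p j)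
    (hpos : 0 < ∑ j, (G.vb j : ℝ) * p j) :
    ∃ x ∈ strategies n G.xa, ∃ y, G.IsFollowerBestResponse x y ∧ winShare x y = p := by
  have ha := G.xa_pos
  have hb := G.xb_pos
  have hv : ∀ j, (0 : ℝ) < G.vb j := fun j => by exact_mod_cast G.vb_pos j
  obtain ⟨l, hl0, hl⟩ : ∃ l : ℝ, 0 < l ∧ ∑ j, (G.vb j : ℝ) * p j = l * (G.xa + G.xb) :=
    ⟨(∑ j, (G.vb j : ℝ) * p j) / (G.xa + G.xb), by positivity, by field_simp⟩
  have hQ : ∑ j, (G.vb j : ℝ) * p j ^ 2 = l * G.xa := by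
    rw [ht, hl, budgetShare]
    field_simp
  let x : Fin n → ℝ := fun j => (G.vb j : ℝ) * p j ^ 2 / l
  let y : Fin n → ℝ := fun j => (G.vb j : ℝ) * p j * (1 - p j) / l
  have hsum : ∀ j, x j + y j = (G.vb j : ℝ) * p j / l := fun j => by
    simp only [x, y]
    ring
  have hx : x ∈ strategies n G.xa := by
    refine ⟨fun j => by have := hv j; positivity, ?_⟩
    rw [← Finset.sum_div, hQ, mul_div_cancel_left₀ _ hl0.ne']
  have hy : y ∈ strategies n G.xb := by
    refine ⟨fun j => div_nonneg (mul_nonneg (mul_nonneg (hv j).le (hp j).1)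
      (sub_nonneg.2 (hp j).2)) hl0.le, ?_⟩
    rw [← Finset.sum_div, sum_share_sub_sq, hQ, hl, div_eq_iff hl0.ne']
    ring
  refine ⟨x, hx, y, ⟨hy, ?_⟩, ?_⟩
  · refine sum_le_of_tangent (l := l) (τ := fun i t => if x i = 0 ∧ t = 0 then (G.vb i : ℝ)
        else t * (G.vb i : ℝ) / (x i + t)) hy fun j t ht => ?_
    have hvj := hv j
    rcases (hp j).1.eq_or_lt with h0 | h0
    · have hx0 : x j = 0 := by simp [x, ← h0]
      have hy0 : y j = 0 := by simp [y, ← h0]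
      rcases ht.eq_or_lt with h1 | h1
      · simp [hx0, hy0, ← h1]
      · have := mul_pos hl0 h1
        simp [hx0, hy0, h1.ne', this.le]
    · have hxj : 0 < x j := by simp only [x]; positivity
      have h := lottery_le_tangent hvj.le hxj (hy.1 j) ht
      have hslope : (G.vb j : ℝ) * x j / (x j + y j) ^ 2 = l := by
        rw [hsum]
        simp only [x]
        field_simp
      rw [hslope] at h
      simpa only [follower_term hxj] using h
  · funext j
    rw [winShare, hsum]
    simp only [x]
    have := (hv j).ne'
    by_cases h0 : p j = 0
    · simp [h0]
    · field_simp

/-! ### Stackelberg equilibria -/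

/-- Some commitment of the leader attains the maximum over the cube and the ball. -/
theorem exists_optimal_profile (hn : 1 ≤ n) :
    ∃ x ∈ strategies n G.xa, ∃ y, G.IsFollowerBestResponse x y ∧
      IsMaxOn (fun q => ∑ j, (G.va j : ℝ) * q j)
        (feasibleShares (fun j => (G.vb j : ℝ)) G.budgetShare) (winShare x y) := by
  have ha : ∀ j, (0 : ℝ) < G.va j := fun j => by exact_mod_cast G.va_pos j
  have hb : ∀ j, (0 : ℝ) < G.vb j := fun j => by exact_mod_cast G.vb_pos j
  have hθ0 := G.budgetShare_pos
  have hθ1 := G.budgetShare_lt_one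
  obtain ⟨p, hp, hmax⟩ :=
    exists_isMaxOn_feasibleShares (fun j => (G.va j : ℝ)) (fun j => (G.vb j : ℝ)) G.budgetShare
  have ht := feasibleShares_tight_of_isMaxOn hn ha hb hθ1 hp hmax
  have hpos : 0 < ∑ j, (G.vb j : ℝ) * p j := by
    refine lt_of_le_of_ne (Finset.sum_nonneg fun j _ => mul_nonneg (hb j).le (hp.1 j).1)
      fun h => ?_
    have h1 := (Finset.sum_eq_zero_iff_of_nonneg
      fun j _ => mul_nonneg (hb j).le (hp.1 j).1).1 h.symm
    have h2 : ∀ j, p j = 0 := fun j => (mul_eq_zero.1 (h1 j (Finset.mem_univ j))).resolve_left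
      (hb j).ne'
    have h3 : ∑ j, (G.va j : ℝ) * G.budgetShare ≤ ∑ j, (G.va j : ℝ) * p j :=
      hmax (const_mem_feasibleShares _ hθ0.le hθ1.le)
    have h4 := sum_pos_of_one_le hn fun j => mul_pos (ha j) hθ0
    simp only [h2, mul_zero, Finset.sum_const_zero] at h3
    linarith
  obtain ⟨x, hx, y, hy, rfl⟩ := G.exists_profile_of_tight hp.1 ht hpos
  exact ⟨x, hx, y, hy, hmax⟩

theorem exists_isStackelbergEquilibrium (hn : 1 ≤ n) :
    ∃ x y : Fin n → ℝ, G.IsStackelbergEquilibrium x y := by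
  obtain ⟨x, hx, y, hy, hmax⟩ := G.exists_optimal_profile hn
  refine ⟨x, y, hx, hy, fun x' hx' y' hy' => ?_⟩
  rw [leaderUtility_eq, leaderUtility_eq]
  exact hmax (winShare_mem_feasibleShares hx' hy')

variable {G}

theorem IsStackelbergEquilibrium.isMaxOn (hn : 1 ≤ n) {x y : Fin n → ℝ}
    (h : G.IsStackelbergEquilibrium x y) :
    IsMaxOn (fun q => ∑ j, (G.va j : ℝ) * q j)
      (feasibleShares (fun j => (G.vb j : ℝ)) G.budgetShare) (winShare x y) := by
  obtain ⟨x', hx', y', hy', hmax⟩ := G.exists_optimal_profile hn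
  intro q hq
  have h1 := h.2.2 x' hx' y' hy'
  rw [leaderUtility_eq, leaderUtility_eq] at h1
  exact (hmax hq).trans h1

/-! ### Nash equilibria -/

/-- In a Nash equilibrium both players spend on every battlefield: the leader would capture an
uncontested battlefield by an arbitrarily small amount, and would not overspend on one which the
follower leaves empty. -/
theorem IsNashEquilibrium.pos {x y : Fin n → ℝ} (h : G.IsNashEquilibrium x y) :
    ∀ j, 0 < x j ∧ 0 < y j := by
  obtain ⟨hL, hF⟩ := h
  have hv : ∀ j, (0 : ℝ) < G.va j := fun j => by exact_mod_cast G.va_pos j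
  have hx : ∀ k, 0 < x k := by
    intro k
    by_contra hk
    have hk0 : x k = 0 := le_antisymm (not_lt.1 hk) (hL.1.1 k)
    have hyk := hF.eq_zero hL.1 hk0
    obtain ⟨j, hj⟩ := exists_pos_of_mem_strategies G.xa_pos hL.1
    have hjk : j ≠ k := by
      rintro rfl
      exact hk hj
    have hyj := hF.1.1 j
    have hcont : ContinuousAt (fun ε => (x j - ε) * (G.va j : ℝ) / (x j - ε + y j)) 0 :=
      ContinuousAt.div (by fun_prop) (by fun_prop) (by simp; positivity)
    have hlim := hcont.tendsto.mono_left (nhdsWithin_le_nhds (s := Set.Ioi 0))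
    simp only [sub_zero] at hlim
    have hlim' := hlim.const_add (G.va k : ℝ)
    have hle := le_of_tendsto hlim' (b := x j * (G.va j : ℝ) / (x j + y j)) (by
      filter_upwards [Ioo_mem_nhdsGT hj] with ε hε
      have h := exchange_le (τ := fun i t => if t = 0 ∧ y i = 0 then 0
        else t * (G.va i : ℝ) / (t + y i)) hL.1 hL.2 hjk hε.1.le hε.2.le
      simpa [hk0, hyk, hε.1.ne', hj.ne', (sub_pos.2 hε.2).ne',
        mul_div_cancel_left₀ _ hε.1.ne'] using h)
    linarith [hv k]
  refine fun j => ⟨hx j, lt_of_le_of_ne (hF.1.1 j) fun hj => ?_⟩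
  obtain ⟨k, hk⟩ := exists_pos_of_mem_strategies G.xb_pos hF.1
  have hjk : j ≠ k := by
    rintro rfl
    exact hk.ne hj
  have hxj := hx j
  have hxk := hx k
  have h := exchange_le (τ := fun i t => if t = 0 ∧ y i = 0 then 0
    else t * (G.va i : ℝ) / (t + y i)) hL.1 hL.2 hjk (half_pos hxj).le (half_le_self hxj.le)
  have hne : x j - x j / 2 ≠ 0 := by linarith
  simp only [leader_term hk, ← hj, hxj.ne', hne, false_and, if_false, add_zero,
    mul_div_cancel_left₀ _ hxj.ne', mul_div_cancel_left₀ _ hne, add_le_add_iff_right] at h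
  have h1 := le_of_mul_le_mul_left h (hv k)
  rw [div_le_div_iff₀ (by positivity) (by positivity)] at h1
  nlinarith [mul_pos hk hxj]

theorem IsNashEquilibrium.leader_marginal_eq {x y : Fin n → ℝ} (h : G.IsNashEquilibrium x y)
    (j k : Fin n) :
    (G.va j : ℝ) * y j / (y j + x j) ^ 2 = (G.va k : ℝ) * y k / (y k + x k) ^ 2 := by
  have hpos := h.pos
  obtain ⟨hL, -⟩ := h
  by_cases hjk : j = k
  · rw [hjk]
  have hle : ∀ j k, j ≠ k →
      (G.va k : ℝ) * y k / (y k + x k) ^ 2 ≤ (G.va j : ℝ) * y j / (y j + x j) ^ 2 :=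
    fun j k hjk => marginal_le (τ := fun i t => if t = 0 ∧ y i = 0 then 0
      else t * (G.va i : ℝ) / (t + y i)) hL.1 hL.2 (hpos j).2 (hpos k).2
      (leader_term (hpos j).2 _) (leader_term (hpos k).2 _) (hpos j).1 hjk
  exact le_antisymm (hle k j (Ne.symm hjk)) (hle j k hjk)

theorem isLeaderBestResponse_of_marginal_eq {x y : Fin n → ℝ} (hx : x ∈ strategies n G.xa)
    (hy : ∀ j, 0 < y j) {l : ℝ} (h : ∀ j, (G.va j : ℝ) * y j / (y j + x j) ^ 2 = l) :
    G.IsLeaderBestResponse x y := by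
  refine ⟨hx, sum_le_of_tangent (l := l) (τ := fun i t => if t = 0 ∧ y i = 0 then 0
      else t * (G.va i : ℝ) / (t + y i)) hx fun j t ht => ?_⟩
  have hv : (0 : ℝ) < G.va j := by exact_mod_cast G.va_pos j
  have h1 := lottery_le_tangent hv.le (hy j) (hx.1 j) ht
  rw [h j] at h1
  simpa only [leader_term (hy j)] using h1

variable (G)

/-- The ratio `va j / vb j` of the values of a battlefield, divided by its quadratic mean. -/
noncomputable def relRatio (j : Fin n) : ℝ :=
  (G.va j : ℝ) / G.vb j / meanRatio (fun j => (G.va j : ℝ)) (fun j => (G.vb j : ℝ))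

/-- The leader's marginal payoff on a battlefield with share `p`, at a profile of the form provided
by `exists_multiplier_of_tight`. The multiplier `l` does not depend on the battlefield. -/
theorem leader_marginal_of_share {a b l p x y : ℝ} (hb : b ≠ 0) (hl : l ≠ 0) (hp : p ≠ 0)
    (hx : b * p ^ 2 = l * x) (hy : b * p * (1 - p) = l * y) :
    a * y / (y + x) ^ 2 = l * (a / b * ((1 - p) / p)) := by
  have h1 : y = b * p * (1 - p) / l := by rw [hy, mul_div_cancel_left₀ _ hl]
  have h2 : x = b * p ^ 2 / l := by rw [hx, mul_div_cancel_left₀ _ hl]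
  have h3 : y + x = b * p / l := by rw [h1, h2]; ring
  rw [h3, h1]
  field_simp

variable {G}

/-- At a Stackelberg equilibrium, the Nash condition says that any two battlefields either have
the same ratio of values or ratios tied to the budgets by one equation. -/
theorem IsStackelbergEquilibrium.isNashEquilibrium_iff (hn : 1 ≤ n) {x y : Fin n → ℝ}
    (h : G.IsStackelbergEquilibrium x y) :
    G.IsNashEquilibrium x y ↔ ∀ j k, G.relRatio j = G.relRatio k ∨
      G.budgetShare * ((1 + G.relRatio j) * (1 + G.relRatio k)) = 2 := by
  have ha : ∀ j, (0 : ℝ) < G.va j := fun j => by exact_mod_cast G.va_pos j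
  have hb : ∀ j, (0 : ℝ) < G.vb j := fun j => by exact_mod_cast G.vb_pos j
  have hθ0 := G.budgetShare_pos
  have hθ1 := G.budgetShare_lt_one
  have hρ := meanRatio_pos hn ha hb
  have hmean := meanRatio_sq hn ha hb
  have hu : ∀ j, 0 < G.relRatio j := fun j => div_pos (div_pos (ha j) (hb j)) hρ
  have hmax := h.isMaxOn hn
  obtain ⟨hx, hy, -⟩ := h
  have hmem := winShare_mem_feasibleShares hx hy
  have ht := feasibleShares_tight_of_isMaxOn hn ha hb hθ1 hmem hmax
  obtain ⟨l, hl, hprof⟩ := exists_multiplier_of_tight hx hy ht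
  have hopt : ∀ j, ballOptimum (fun j => (G.va j : ℝ)) (fun j => (G.vb j : ℝ)) G.budgetShare j =
      G.budgetShare / 2 * (1 + G.relRatio j) := fun j => rfl
  have hratio : ∀ j, (G.va j : ℝ) / G.vb j = G.relRatio j *
      meanRatio (fun j => (G.va j : ℝ)) (fun j => (G.vb j : ℝ)) := fun j =>
    (div_mul_cancel₀ _ hρ.ne').symm
  constructor
  · intro hN j k
    have hpos := hN.pos
    have hint : ∀ j, 0 < winShare x y j ∧ winShare x y j < 1 := fun j => by
      have h1 := (hpos j).1
      have h2 := (hpos j).2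
      exact ⟨by rw [winShare]; positivity, by rw [winShare, div_lt_one (by positivity)]; linarith⟩
    have hp := eq_ballOptimum_of_isMaxOn_of_interior hn ha hb hθ0 hmem hmax hint
    have hm := hN.leader_marginal_eq j k
    rw [leader_marginal_of_share (hb j).ne' hl.ne' (hint j).1.ne' (hprof j).1 (hprof j).2,
      leader_marginal_of_share (hb k).ne' hl.ne' (hint k).1.ne' (hprof k).1 (hprof k).2,
      hp, hopt, hopt, hratio, hratio] at hm
    have hj := hu j
    have hk := hu k
    have hm1 := mul_left_cancel₀ hl.ne' hm
    generalize G.relRatio j = u at *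
    generalize G.relRatio k = w at *
    generalize G.budgetShare = θ at *
    generalize meanRatio (fun j => (G.va j : ℝ)) (fun j => (G.vb j : ℝ)) = ρ at *
    have h1 : 0 < 1 + u := by positivity
    have h2 : 0 < 1 + w := by positivity
    field_simp at hm1
    have h3 : (u - w) * (θ * ((1 + u) * (1 + w)) - 2) = 0 := by linear_combination -hm1
    rcases mul_eq_zero.1 h3 with h4 | h4
    · exact Or.inl (sub_eq_zero.1 h4)
    · exact Or.inr (sub_eq_zero.1 h4)
  · intro hcond
    have hlt : ∀ j, G.budgetShare / 2 * (1 + G.relRatio j) < 1 := by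
      intro j
      have hj := hu j
      by_cases hall : ∀ k, G.relRatio j = G.relRatio k
      · -- If all ratios are equal, then they equal their mean, so `relRatio j = 1`.
        have h1 : ∀ k, (G.va k : ℝ) ^ 2 / G.vb k = (G.relRatio j *
            meanRatio (fun j => (G.va j : ℝ)) (fun j => (G.vb j : ℝ))) ^ 2 * G.vb k := by
          intro k
          rw [hall k, ← hratio]
          have := (hb k).ne'
          field_simp
        rw [Finset.sum_congr rfl fun k _ => h1 k, ← Finset.mul_sum] at hmean
        have h2 := mul_right_cancel₀ (sum_pos_of_one_le hn hb).ne' hmean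
        have h3 := (pow_left_inj₀ hρ.le (by positivity) two_ne_zero).1 h2
        have h4 : G.relRatio j = 1 := by
          refine mul_right_cancel₀ hρ.ne' ?_
          rw [one_mul]
          exact h3.symm
        rw [h4]
        linarith
      · push Not at hall
        obtain ⟨k, hk⟩ := hall
        have h1 := (hcond j k).resolve_left hk
        have h2 := mul_pos (mul_pos hθ0 (by positivity : 0 < 1 + G.relRatio j)) (hu k)
        linarith
    have hge : ∀ j, 0 < G.budgetShare / 2 * (1 + G.relRatio j) := fun j => by
      have := hu j
      positivity
    have hoptmem : ballOptimum (fun j => (G.va j : ℝ)) (fun j => (G.vb j : ℝ)) G.budgetShare ∈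
        feasibleShares (fun j => (G.vb j : ℝ)) G.budgetShare :=
      ⟨fun j => ⟨(hge j).le, (hlt j).le⟩, (ballOptimum_tight hn ha hb _).le⟩
    have hp := eq_ballOptimum_of_le hn ha hb hθ0 hmem.2 (hmax hoptmem)
    have hpj : ∀ j, winShare x y j = G.budgetShare / 2 * (1 + G.relRatio j) := fun j => by
      rw [hp, hopt]
    have hypos : ∀ j, 0 < y j := fun j => by
      have h1 := (hprof j).2
      rw [hpj] at h1
      have h2 := mul_pos (mul_pos (hb j) (hge j)) (sub_pos.2 (hlt j))
      rw [h1] at h2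
      exact (mul_pos_iff_of_pos_left hl).1 h2
    refine ⟨?_, hy⟩
    have hm : ∀ j, (G.va j : ℝ) * y j / (y j + x j) ^ 2 =
        (G.va ⟨0, hn⟩ : ℝ) * y ⟨0, hn⟩ / (y ⟨0, hn⟩ + x ⟨0, hn⟩) ^ 2 := by
      intro j
      generalize (⟨0, hn⟩ : Fin n) = k
      rw [leader_marginal_of_share (hb j).ne' hl.ne' (by rw [hpj]; exact (hge j).ne')
          (hprof j).1 (hprof j).2,
        leader_marginal_of_share (hb k).ne' hl.ne' (by rw [hpj]; exact (hge k).ne')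
          (hprof k).1 (hprof k).2, hpj, hpj, hratio, hratio]
      have hj := hu j
      have hk := hu k
      have hcjk := hcond j k
      generalize G.relRatio j = u at *
      generalize G.relRatio k = w at *
      generalize G.budgetShare = θ at *
      generalize meanRatio (fun j => (G.va j : ℝ)) (fun j => (G.vb j : ℝ)) = ρ at *
      rcases hcjk with hc | hc
      · rw [hc]
      · have h1 : 0 < 1 + u := by positivity
        have h2 : 0 < 1 + w := by positivity
        field_simp
        linear_combination (w - u) * hc
    exact isLeaderBestResponse_of_marginal_eq hx hypos hm

/-! ### The two classes of battlefields -/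

theorem relRatio_eq_iff (hn : 1 ≤ n) {j k : Fin n} :
    G.relRatio j = G.relRatio k ↔ G.va j / G.vb j = G.va k / G.vb k := by
  have hρ := meanRatio_pos hn (a := fun j => (G.va j : ℝ)) (b := fun j => (G.vb j : ℝ))
    (fun j => by exact_mod_cast G.va_pos j) (fun j => by exact_mod_cast G.vb_pos j)
  rw [relRatio, relRatio, div_left_inj' hρ.ne']
  norm_cast

/-- For a partition into two classes with different ratios of values, the critical budget ratio is
`blottoF` of the total values of the classes. -/
theorem budget_ratio_eq_blottoF_iff (hn : 1 ≤ n) {M : Finset (Fin n)} {i k : Fin n}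
    (hi : i ∈ M) (hk : k ∈ Mᶜ) (hik : G.relRatio i ≠ G.relRatio k)
    (hM : ∀ j ∈ M, G.relRatio j = G.relRatio i) (hM' : ∀ j ∈ Mᶜ, G.relRatio j = G.relRatio k) :
    G.xa / G.xb = blottoF (∑ j ∈ M, (G.va j : ℝ)) (∑ j ∈ M, (G.vb j : ℝ))
        (∑ j ∈ Mᶜ, (G.va j : ℝ)) (∑ j ∈ Mᶜ, (G.vb j : ℝ)) ↔
      G.budgetShare * ((1 + G.relRatio i) * (1 + G.relRatio k)) = 2 := by
  have ha : ∀ j, (0 : ℝ) < G.va j := fun j => by exact_mod_cast G.va_pos j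
  have hb : ∀ j, (0 : ℝ) < G.vb j := fun j => by exact_mod_cast G.vb_pos j
  have hρ := meanRatio_pos hn ha hb
  have hmean := meanRatio_sq hn ha hb
  have hu : ∀ j, 0 < G.relRatio j := fun j => div_pos (div_pos (ha j) (hb j)) hρ
  have hva : ∀ j, (G.va j : ℝ) = G.relRatio j *
      meanRatio (fun j => (G.va j : ℝ)) (fun j => (G.vb j : ℝ)) * G.vb j := fun j => by
    rw [relRatio, div_mul_cancel₀ _ hρ.ne', div_mul_cancel₀ _ (hb j).ne']
  have hui := hu i
  have huk := hu k
  generalize meanRatio (fun j => (G.va j : ℝ)) (fun j => (G.vb j : ℝ)) = ρ at *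
  have hsum : ∀ (N : Finset (Fin n)) (m : Fin n), (∀ j ∈ N, G.relRatio j = G.relRatio m) →
      ∑ j ∈ N, (G.va j : ℝ) = G.relRatio m * ρ * ∑ j ∈ N, (G.vb j : ℝ) ∧
      ∑ j ∈ N, (G.va j : ℝ) ^ 2 / G.vb j = (G.relRatio m * ρ) ^ 2 * ∑ j ∈ N, (G.vb j : ℝ) := by
    intro N m h
    rw [Finset.mul_sum, Finset.mul_sum]
    refine ⟨Finset.sum_congr rfl fun j hj => ?_, Finset.sum_congr rfl fun j hj => ?_⟩
    · rw [hva, h j hj]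
    · have := (hb j).ne'
      rw [hva, h j hj]
      field_simp
  obtain ⟨h1, h2⟩ := hsum M i hM
  obtain ⟨h3, h4⟩ := hsum Mᶜ k hM'
  rw [← Finset.sum_add_sum_compl M, ← Finset.sum_add_sum_compl M (fun j => _ / _), h2, h4] at hmean
  have hB : 0 < ∑ j ∈ M, (G.vb j : ℝ) := Finset.sum_pos (fun j _ => hb j) ⟨i, hi⟩
  have hD : 0 < ∑ j ∈ Mᶜ, (G.vb j : ℝ) := Finset.sum_pos (fun j _ => hb j) ⟨k, hk⟩
  have hne : G.relRatio i * ρ ≠ G.relRatio k * ρ := fun h => hik (mul_right_cancel₀ hρ.ne' h)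
  have hlt := two_mul_sq_lt_of_ratio_ne hB hD (mul_pos hui hρ) (mul_pos huk hρ) hρ hne hmean
  rw [h1, h3, blottoF_eq hB hD (mul_pos hui hρ) (mul_pos huk hρ) hρ hne hmean, budgetShare]
  have hxa := G.xa_pos
  have hxb := G.xb_pos
  rw [div_eq_div_iff hxb.ne' (sub_pos.2 hlt).ne', div_mul_eq_mul_div, div_eq_iff (by positivity)]
  constructor
  · intro h
    refine mul_left_cancel₀ (pow_ne_zero 2 hρ.ne') ?_
    linear_combination h
  · intro h
    linear_combination ρ ^ 2 * h

/-- The pairwise form of the Nash condition allows at most two different ratios of values. -/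
theorem pairwise_iff_two_classes (hn : 1 ≤ n) :
    (∀ j k, G.relRatio j = G.relRatio k ∨
      G.budgetShare * ((1 + G.relRatio j) * (1 + G.relRatio k)) = 2) ↔
    (∃ c : ℚ, ∀ j, G.va j / G.vb j = c) ∨
      (∃ M : Finset (Fin n), M ⊂ Finset.univ ∧
        (∀ j ∈ M, ∀ k ∈ M, G.va j / G.vb j = G.va k / G.vb k) ∧
        (∀ j ∈ Mᶜ, ∀ k ∈ Mᶜ, G.va j / G.vb j = G.va k / G.vb k) ∧
        G.xa / G.xb =
          blottoF (∑ j ∈ M, (G.va j : ℝ)) (∑ j ∈ M, (G.vb j : ℝ))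
            (∑ j ∈ Mᶜ, (G.va j : ℝ)) (∑ j ∈ Mᶜ, (G.vb j : ℝ))) := by
  simp only [← relRatio_eq_iff hn]
  constructor
  · intro h
    by_cases hall : ∀ j k, G.relRatio j = G.relRatio k
    · exact Or.inl ⟨_, fun j => (relRatio_eq_iff hn).1 (hall j ⟨0, hn⟩)⟩
    · push Not at hall
      obtain ⟨i, k, hik⟩ := hall
      have hother : ∀ j, G.relRatio j ≠ G.relRatio i → G.relRatio j = G.relRatio k := by
        intro j hj
        have h1 := (h i j).resolve_left (Ne.symm hj)
        have h2 := (h i k).resolve_left hik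
        have h3 : G.budgetShare * (1 + G.relRatio i) ≠ 0 := fun h0 => by
          rw [← mul_assoc, h0, zero_mul] at h1
          norm_num at h1
        have h4 := mul_left_cancel₀ h3 (b := 1 + G.relRatio j) (c := 1 + G.relRatio k)
          (by linear_combination h1 - h2)
        linarith
      classical
      let M : Finset (Fin n) := {j | G.relRatio j = G.relRatio i}
      have hM : ∀ j, j ∈ M ↔ G.relRatio j = G.relRatio i := by simp [M]
      have hM1 : ∀ j ∈ M, G.relRatio j = G.relRatio i := fun j => (hM j).1
      have hM2 : ∀ j ∈ Mᶜ, G.relRatio j = G.relRatio k := fun j hj =>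
        hother j fun h => Finset.mem_compl.1 hj ((hM j).2 h)
      have hi : i ∈ M := (hM i).2 rfl
      have hk : k ∈ Mᶜ := Finset.mem_compl.2 fun h => hik ((hM k).1 h).symm
      refine Or.inr ⟨M, ?_, fun j hj m hm => (hM1 j hj).trans (hM1 m hm).symm,
        fun j hj m hm => (hM2 j hj).trans (hM2 m hm).symm, ?_⟩
      · exact Finset.ssubset_univ_iff.2 fun h => by simp [h] at hk
      · exact (budget_ratio_eq_blottoF_iff hn hi hk hik hM1 hM2).2 ((h i k).resolve_left hik)
  · rintro (⟨c, hc⟩ | ⟨M, -, hM, hM', hf⟩) j k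
    · exact Or.inl ((relRatio_eq_iff hn).2 ((hc j).trans (hc k).symm))
    · by_cases hjk : G.relRatio j = G.relRatio k
      · exact Or.inl hjk
      · right
        by_cases hj : j ∈ M <;> by_cases hk : k ∈ M
        · exact absurd (hM j hj k hk) hjk
        · have hk' := Finset.mem_compl.2 hk
          exact (budget_ratio_eq_blottoF_iff hn hj hk' hjk (fun m hm => hM m hm j hj)
            fun m hm => hM' m hm k hk').1 hf
        · have hj' := Finset.mem_compl.2 hj
          rw [mul_comm (1 + G.relRatio j)]
          exact (budget_ratio_eq_blottoF_iff hn hk hj' (Ne.symm hjk) (fun m hm => hM m hm k hk)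
            fun m hm => hM' m hm j hj').1 hf
        · exact absurd (hM' j (Finset.mem_compl.2 hj) k (Finset.mem_compl.2 hk)) hjk

end LotteryBlotto

theorem theorem3 {n : ℕ} (hn : 1 ≤ n) (G : LotteryBlotto n) :
    (∃ x y : Fin n → ℝ, G.IsStackelbergEquilibrium x y) ∧
    ∀ x y : Fin n → ℝ, G.IsStackelbergEquilibrium x y →
      (G.IsNashEquilibrium x y ↔
        (∃ c : ℚ, ∀ j, G.va j / G.vb j = c) ∨
        (∃ M : Finset (Fin n), M ⊂ Finset.univ ∧
          (∀ j ∈ M, ∀ k ∈ M, G.va j / G.vb j = G.va k / G.vb k) ∧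
          (∀ j ∈ Mᶜ, ∀ k ∈ Mᶜ, G.va j / G.vb j = G.va k / G.vb k) ∧
          G.xa / G.xb =
            blottoF (∑ j ∈ M, (G.va j : ℝ)) (∑ j ∈ M, (G.vb j : ℝ))
              (∑ j ∈ Mᶜ, (G.va j : ℝ)) (∑ j ∈ Mᶜ, (G.vb j : ℝ)))) :=
  ⟨G.exists_isStackelbergEquilibrium hn, fun _ _ h =>
    (h.isNashEquilibrium_iff hn).trans (LotteryBlotto.pairwise_iff_two_classes hn)⟩
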